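/- **Theorem 4.4 (Brunn–Minkowski inequality).** Let $(X,d)$ be a complete separable metric space with a $\sigma$-finite Borel measure $\mathfrak m$, and let $K\in\mathbb R$, $N<0$. *Notation.* For $\kappa\in\mathbb R$ let $\mathfrak s_\kappa(\theta)$ be $\sin(\sqrt\kappa\,\theta)/\sqrt\kappa$, $\theta$, $\sinh(\sqrt{-\kappa}\,\theta)/\sqrt{-\kappa}$ for $\kappa>0$, $\kappa=0$, $\kappa<0$ respectively. For $t\in[0,1]$ and $\theta\ge 0$ let $\sigma_\kappa^{(t)}(\theta)=\mathfrak s_\kappa(t\theta)/\mathfrak s_\kappa(\theta)$ for $\theta>0$, $\sigma^{(t)}_\kappa(0)=t$, except that $\sigma_\kappa^{(t)}(\theta)=\infty$ if $\kappa>0$ and $\theta\ge\pi/\sqrt\kappa$. Let $\tau^{(t)}_{K,N}(\theta)=t^{1/N}\sigma^{(t)}_{K/(N-1)}(\theta)^{(N-1)/N}$ for $t\in(0,1]$ and $\tau^{(0)}_{K,N}(\theta)=0$, except that $\tau^{(t)}_{K,N}(\theta)=\infty$ if $K<0$ and $\theta\ge\pi\sqrt{(N-1)/K}$. A minimal geodesic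 of a metric space is a curve $\gamma$ on $[0,1]$ with $d(\gamma(s),\gamma(t))=|s-t|\,d(\gamma(0),\gamma(1))$ for all $s,t\in[0,1]$. Let $\mathcal P^2(X)$ be the set of Borel probability measures with finite second moment, with the $L^2$-Wasserstein distance $W_2$. Let $S_N(\mu)=\int_X\rho^{(N-1)/N}\,d\mathfrak m$ if $\mu=\rho\,\mathfrak m\ll\mathfrak m$, and $S_N(\mu)=\infty$ otherwise. The space $(X,d,\mathfrak m)$ satisfies $\mathrm{CD}(K,N)$ if any $\mu_0=\rho_0\mathfrak m$, $\mu_1=\rho_1\mathfrak m$ in $\mathcal P^2(X)$ admit a minimal geodesic $(\mu_t)_{t\in[0,1]}$ of $(\mathcal P^2(X),W_2)$ from $\mu_0$ to $\mu_1$ and a $W_2$-optimal coupling $\pi$ of $\mu_0$ and $\mu_1$ such that $$S_{N'}(\mu_t)\le\int_{X\times X}\Big\{\tau^{(1-t)}_{K,N'}(d(x,y))\,\rho_0(x)^{-1/N'}+\tau^{(t)}_{K,N'}(d(x,y))\,\rho_1(y)^{-1/N'}\Big\}\,\pi(dx\,dy)$$ for all $t\in[0,1]$ and all $N'\in[N,0)$.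 It satisfies $\mathrm{CD}^*(K,N)$ if the same holds with $\sigma^{(\cdot)}_{K/N'}$ in place of $\tau^{(\cdot)}_{K,N'}$. *Statement.* For $A_0,A_1\subset X$ and $t\in[0,1]$ let $A_t$ be the set of all points $\gamma(t)$, where $\gamma$ is a minimal geodesic in $X$ with $\gamma(0)\in A_0$ and $\gamma(1)\in A_1$. Let $A_0,A_1$ be nonempty Borel sets and let $t\in[0,1]$, where $\mathfrak m[A_1]>0$ if $t=0$ and $\mathfrak m[A_0]>0$ if $t=1$. Below, $\mathfrak m[A_t]$ is the outer measure of $A_t$, $0^{1/N}=\infty$, $\infty^{1/N}=0$, and $0\cdot\infty=0$. (i) If $(X,d,\mathfrak m)$ satisfies $\mathrm{CD}(K,N)$ and, in case $K<0$, $\operatorname{diam}(A_0\cup A_1)<\pi\sqrt{(N-1)/K}$, then $$\mathfrak m[A_t]^{1/N}\le\sup_{x\in A_0,\,y\in A_1}\tau^{(1-t)}_{K,N}(d(x,y))\;\mathfrak m[A_0]^{1/N}+\sup_{x\in A_0,\,y\in A_1}\tau^{(t)}_{K,N}(d(x,y))\;\mathfrak m[A_1]^{1/N}.$$ (ii) If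 $(X,d,\mathfrak m)$ satisfies $\mathrm{CD}^*(K,N)$ and, in case $K<0$, $\operatorname{diam}(A_0\cup A_1)<\pi\sqrt{N/K}$, then $$\mathfrak m[A_t]^{1/N}\le\sup_{x\in A_0,\,y\in A_1}\sigma^{(1-t)}_{K/N}(d(x,y))\;\mathfrak m[A_0]^{1/N}+\sup_{x\in A_0,\,y\in A_1}\sigma^{(t)}_{K/N}(d(x,y))\;\mathfrak m[A_1]^{1/N}.$$ -/

import Mathlib

open MeasureTheory Set
open scoped ENNReal

noncomputable section

namespace NegCD

/-- The comparison function `𝔰_κ`, the solution of `u'' + κ u = 0`, `u 0 = 0`, `u' 0 = 1`. -/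
def sinK (κ θ : ℝ) : ℝ :=
  if 0 < κ then Real.sin (√κ * θ) / √κ
  else if κ = 0 then θ
  else Real.sinh (√(-κ) * θ) / √(-κ)

/-- The distortion coefficient `σ_κ^{(t)}(θ) = 𝔰_κ(tθ) / 𝔰_κ(θ)`, with `σ_κ^{(t)}(0) = t`, and with
the value `∞` if `κ > 0` and `θ ≥ π / √κ`. -/
def sigma (κ t θ : ℝ) : ℝ≥0∞ :=
  if 0 < κ ∧ Real.pi / √κ ≤ θ then ∞
  else if θ = 0 then ENNReal.ofReal t
  else ENNReal.ofReal (sinK κ (t * θ) / sinK κ θ)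

/-- The distortion coefficient `τ_{K,N}^{(t)}(θ) = t^{1/N} σ_{K/(N-1)}^{(t)}(θ)^{(N-1)/N}`, with
`τ_{K,N}^{(0)}(θ) = 0`, and with the value `∞` if `K < 0` and `θ ≥ π √((N-1)/K)`. -/
def tau (K N t θ : ℝ) : ℝ≥0∞ :=
  if K < 0 ∧ Real.pi * √((N - 1) / K) ≤ θ then ∞
  else if t = 0 then 0
  else ENNReal.ofReal t ^ (1 / N) * sigma (K / (N - 1)) t θ ^ ((N - 1) / N)

section Metric

variable {X : Type*} [MetricSpace X]

/-- Minimal geodesics `γ : [0,1] → X`: minimizing curves of constant speed. (The values of `γ`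
outside `[0,1]` play no role.) -/
def IsMinimalGeodesic (γ : ℝ → X) : Prop :=
  ∀ s ∈ Icc (0 : ℝ) 1, ∀ t ∈ Icc (0 : ℝ) 1, dist (γ s) (γ t) = |s - t| * dist (γ 0) (γ 1)

/-- The set of all `γ(t)`, for minimal geodesics `γ` from a point of `A₀` to a point of `A₁`. -/
def intermediateSet (A₀ A₁ : Set X) (t : ℝ) : Set X :=
  {z | ∃ γ : ℝ → X, IsMinimalGeodesic γ ∧ γ 0 ∈ A₀ ∧ γ 1 ∈ A₁ ∧ γ t = z}

variable [MeasurableSpace X]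

/-- The Borel probability measures with finite second moment. -/
def IsP2 (μ : Measure X) : Prop :=
  IsProbabilityMeasure μ ∧ ∃ x₀ : X, ∫⁻ x, edist x x₀ ^ 2 ∂μ < ∞

/-- The couplings of `μ` and `ν`. -/
def IsCoupling (μ ν : Measure X) (π : Measure (X × X)) : Prop :=
  π.map Prod.fst = μ ∧ π.map Prod.snd = ν

/-- The `L²` transport cost `(∫ d(x,y)² π(dxdy))^{1/2}` of a coupling. -/
def transportCost (π : Measure (X × X)) : ℝ≥0∞ :=
  (∫⁻ p, edist p.1 p.2 ^ 2 ∂π) ^ (1 / 2 : ℝ)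

/-- The `L²`-Wasserstein distance. -/
def W2 (μ ν : Measure X) : ℝ≥0∞ :=
  ⨅ (π : Measure (X × X)) (_ : IsCoupling μ ν π), transportCost π

/-- Couplings attaining the infimum in the definition of the Wasserstein distance. -/
def IsOptimalCoupling (μ ν : Measure X) (π : Measure (X × X)) : Prop :=
  IsCoupling μ ν π ∧ transportCost π = W2 μ ν

/-- Minimal geodesics `(μ_t)_{t ∈ [0,1]}` in the space of probability measures with finite second
moment, with respect to the Wasserstein distance. -/
def IsW2Geodesic (μ : ℝ → Measure X) : Prop :=
  (∀ t ∈ Icc (0 : ℝ) 1, IsP2 (μ t)) ∧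
    ∀ s ∈ Icc (0 : ℝ) 1, ∀ t ∈ Icc (0 : ℝ) 1,
      W2 (μ s) (μ t) = ENNReal.ofReal |s - t| * W2 (μ 0) (μ 1)

open Classical in
/-- The Rényi entropy `S_N(μ) = ∫ ρ^{(N-1)/N} d𝔪` if `μ = ρ 𝔪` is absolutely continuous with respect
to `𝔪`, and `S_N(μ) = ∞` otherwise. -/
def renyiEntropy (m : Measure X) (N : ℝ) (μ : Measure X) : ℝ≥0∞ :=
  if μ ≪ m then ∫⁻ x, μ.rnDeriv m x ^ ((N - 1) / N) ∂m else ∞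

/-- The curvature-dimension inequality with distortion coefficients `β N' t θ`, for all
`N' ∈ [N, 0)`. One geodesic and one optimal coupling serve all `t` and all `N'`. -/
def CurvDimWith (β : ℝ → ℝ → ℝ → ℝ≥0∞) (N : ℝ) (m : Measure X) : Prop :=
  ∀ μ₀ μ₁ : Measure X, IsP2 μ₀ → IsP2 μ₁ → μ₀ ≪ m → μ₁ ≪ m →
    ∃ (μ : ℝ → Measure X) (π : Measure (X × X)),
      IsW2Geodesic μ ∧ μ 0 = μ₀ ∧ μ 1 = μ₁ ∧ IsOptimalCoupling μ₀ μ₁ π ∧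
      ∀ t ∈ Icc (0 : ℝ) 1, ∀ N' ∈ Ico N 0,
        renyiEntropy m N' (μ t) ≤
          ∫⁻ p, (β N' (1 - t) (dist p.1 p.2) * μ₀.rnDeriv m p.1 ^ (-1 / N') +
            β N' t (dist p.1 p.2) * μ₁.rnDeriv m p.2 ^ (-1 / N')) ∂π

/-- The curvature-dimension condition `CD(K,N)`, for `N < 0`. -/
def CD (K N : ℝ) (m : Measure X) : Prop :=
  CurvDimWith (fun N' t θ => tau K N' t θ) N m

/-- The reduced curvature-dimension condition `CD*(K,N)`, for `N < 0`. -/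
def CDStar (K N : ℝ) (m : Measure X) : Prop :=
  CurvDimWith (fun N' t θ => sigma (K / N') t θ) N m

end Metric

end NegCD

end

/-! ### Gluing couplings along finitely many times -/

namespace NegCD

open ProbabilityTheory

section

variable {X : Type*} [MeasurableSpace X]

/-! For sets of positive finite measure, join the uniform distributions on `A₀` and `A₁` by the
Wasserstein geodesic `μ t` of the curvature-dimension condition. Their densities are `1 / m A₀` and
`1 / m A₁`, so the right-hand side of the entropy inequality is at most the right-hand side of
Brunn–Minkowski. Since `(N - 1) / N > 1`, Jensen's inequality bounds the entropy of a probability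
measure carried by a set `E` below by `m E ^ (1 / N)`. It remains to know that `μ t` is carried by
the intermediate set.

That is the main work, because the condition supplies a geodesic of measures and not a measure on
geodesics. Almost optimal couplings between finitely many times are glued into one random path
(`exists_chain`). A quadratic inequality and Chebyshev show that the path is geodesic at those
times, up to a small error and with high probability (`measure_chain_defect_le`,
`exists_almost_geodesic_chain`). Tightness and a compactness argument over a dense sequence of times
then give a measurable subset of the intermediate set carrying all but `ε` of the mass of `μ t`
(`IsW2Geodesic.exists_subset_intermediateSet`). Such a subset also copes with the intermediate set
being possibly non-measurable.

`CurvDimWith.brunnMinkowski_of_bounded` combines this with Jensen and lets `ε` tend to `0`.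
`CurvDimWith.brunnMinkowski` treats null sets and exhausts general ones. It is stated for arbitrary
coefficients that are bounded, and nonzero for positive times; the diameter condition serves to
bound `τ` and `σ`. -/

theorem IsCoupling.isProbabilityMeasure {μ ν : Measure X} [IsProbabilityMeasure μ]
    {π : Measure (X × X)} (h : IsCoupling μ ν π) : IsProbabilityMeasure π := by
  constructor
  have : π.map Prod.fst univ = 1 := by rw [h.1]; exact measure_univ
  rwa [Measure.map_apply measurable_fst MeasurableSet.univ, preimage_univ] at this

/-- Appending to a random variable `f` on `(Ω, P)` a second one, so that the joint law is a given
measure `π` with first marginal the law of `f`. -/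
theorem exists_gluing {Ω : Type*} [MeasurableSpace Ω] [StandardBorelSpace X] [Nonempty X]
    (P : Measure Ω) [IsProbabilityMeasure P] {f : Ω → X} (hf : Measurable f)
    (π : Measure (X × X)) [IsProbabilityMeasure π] (hπ : P.map f = π.map Prod.fst) :
    ∃ Q : Measure (Ω × X), IsProbabilityMeasure Q ∧ Q.map Prod.fst = P ∧
      Q.map (fun p => (f p.1, p.2)) = π := by
  refine ⟨P ⊗ₘ (π.condKernel.comap f hf), inferInstance, Measure.fst_compProd .., ?_⟩
  refine Measure.ext_of_lintegral _ fun g hg => ?_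
  rw [lintegral_map hg (by fun_prop), Measure.lintegral_compProd (by fun_prop)]
  conv_rhs => rw [← π.disintegrate π.condKernel, Measure.lintegral_compProd hg, Measure.fst, ← hπ]
  rw [lintegral_map (hg.lintegral_kernel_prod_right') hf]
  rfl

end

variable {X : Type*} [MetricSpace X] [MeasurableSpace X]

/-- The slack `δ` makes it unnecessary to know that optimal couplings exist between intermediate
times. -/
theorem exists_coupling_transportCost_le {μ ν : Measure X} {c δ : ℝ≥0∞} (hc : c ≠ ∞) (hδ : δ ≠ 0)
    (h : W2 μ ν ≤ c) : ∃ π, IsCoupling μ ν π ∧ transportCost π ≤ c + δ := by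
  have : W2 μ ν < c + δ := h.trans_lt (ENNReal.lt_add_right hc hδ)
  simp only [W2, iInf_lt_iff] at this
  obtain ⟨π, h1, h2⟩ := this
  exact ⟨π, h1, h2.le⟩

/-- Gluing almost optimal couplings between finitely many consecutive times. -/
theorem exists_chain [BorelSpace X] [SecondCountableTopology X] [StandardBorelSpace X]
    (μ : ℝ → Measure X) {W : ℝ≥0∞} (hW : W ≠ ∞) (F : Finset ℝ) (hne : F.Nonempty)
    (hprob : ∀ q ∈ F, IsProbabilityMeasure (μ q))
    (hμ : ∀ q ∈ F, ∀ r ∈ F, q ≤ r → W2 (μ q) (μ r) ≤ ENNReal.ofReal (r - q) * W)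
    {δ : ℝ≥0∞} (hδ : δ ≠ 0) :
    ∃ P : Measure (ℝ → X), IsProbabilityMeasure P ∧ (∀ q ∈ F, P.map (fun ω => ω q) = μ q) ∧
      ∀ q ∈ F, ∀ r ∈ F, q ≤ r →
        (∫⁻ ω, edist (ω q) (ω r) ^ (2 : ℝ) ∂P) ^ (1 / (2 : ℝ)) ≤ ENNReal.ofReal (r - q) * W + δ := by
  -- The new time `b` exceeds all old ones, so one coupling glued at the largest old time `a`
  -- suffices. Pairs `(q, b)` follow from Minkowski's inequality in `L²`, as the bounds add up: `(a
  -- - q) + (b - a) = b - q`.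
  induction F using Finset.induction_on_max generalizing δ with
  | empty => simp at hne
  | insert b F hb ih =>
    rcases F.eq_empty_or_nonempty with rfl | hF
    · have := hprob b (by simp)
      have hcst : Measurable fun (x : X) (_ : ℝ) => x := measurable_pi_lambda _ fun _ => measurable_id
      refine ⟨(μ b).map (fun x _ => x), Measure.isProbabilityMeasure_map hcst.aemeasurable, ?_, ?_⟩
      · intro q hq
        obtain rfl : q = b := by simpa using hq
        rw [Measure.map_map (by fun_prop) hcst]
        exact Measure.map_id
      · intro q hq r hr _
        obtain rfl : q = b := by simpa using hq
        obtain rfl : r = q := by simpa using hr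
        simp
    · have hδ2 : δ / 2 ≠ 0 := by simpa using hδ
      obtain ⟨P, hP, hm, hd⟩ := ih hF (fun q hq => hprob q (by simp [hq]))
        (fun q hq r hr => hμ q (by simp [hq]) r (by simp [hr])) hδ2
      set a := F.max' hF with ha
      have haF : a ∈ F := F.max'_mem hF
      have hab : a < b := hb a haF
      have hPa := hprob a (by simp [haF])
      obtain ⟨π, hπ, hcost⟩ := exists_coupling_transportCost_le
        (ENNReal.mul_ne_top ENNReal.ofReal_ne_top hW) hδ2
        (hμ a (by simp [haF]) b (by simp) hab.le)
      have := hπ.isProbabilityMeasure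
      have : Nonempty X := by
        by_contra h
        rw [not_nonempty_iff] at h
        exact IsProbabilityMeasure.ne_zero (μ a) (Measure.eq_zero_of_isEmpty _)
      obtain ⟨Q, hQ, hQ1, hQ2⟩ := exists_gluing P (f := fun ω => ω a) (by fun_prop) π
        ((hm a haF).trans hπ.1.symm)
      have hup : Measurable fun p : (ℝ → X) × X => Function.update p.1 b p.2 := measurable_update'
      have old : ∀ q ∈ F, ∀ p : (ℝ → X) × X, Function.update p.1 b p.2 q = p.1 q := fun q hq p =>
        Function.update_of_ne (hb q hq).ne _ _
      have hcost' : (∫⁻ p, edist (p.1 a) p.2 ^ (2 : ℝ) ∂Q) ^ (1 / (2 : ℝ)) ≤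
          ENNReal.ofReal (b - a) * W + δ / 2 := by
        refine le_trans (le_of_eq ?_) hcost
        rw [transportCost, ← hQ2, lintegral_map (by fun_prop) (by fun_prop)]
        simp
      have hd' : ∀ q ∈ F, ∀ r ∈ F, q ≤ r →
          (∫⁻ p, edist (p.1 q) (p.1 r) ^ (2 : ℝ) ∂Q) ^ (1 / (2 : ℝ)) ≤
            ENNReal.ofReal (r - q) * W + δ / 2 := by
        intro q hq r hr hqr
        refine le_trans (le_of_eq ?_) (hd q hq r hr hqr)
        rw [← hQ1, lintegral_map (by fun_prop) (by fun_prop)]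
      refine ⟨Q.map (fun p => Function.update p.1 b p.2),
        Measure.isProbabilityMeasure_map hup.aemeasurable, ?_, ?_⟩
      · intro q hq
        rw [Measure.map_map (by fun_prop) hup]
        rcases Finset.mem_insert.1 hq with rfl | hq
        · rw [← hπ.2, ← hQ2, Measure.map_map (by fun_prop) (by fun_prop)]
          congr 1
          ext p
          simp
        · rw [← hm q hq, ← hQ1, Measure.map_map (by fun_prop) (by fun_prop)]
          congr 1
          ext p
          simp [old q hq]
      · intro q hq r hr hqr
        rw [lintegral_map (by fun_prop) hup]
        rcases Finset.mem_insert.1 hr with rfl | hr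
        · rcases Finset.mem_insert.1 hq with rfl | hq
          · simp
          · simp only [old q hq, Function.update_self]
            have hqa : q ≤ a := F.le_max' q hq
            calc (∫⁻ p, edist (p.1 q) p.2 ^ (2 : ℝ) ∂Q) ^ (1 / (2 : ℝ))
                ≤ (∫⁻ p, ((fun p : (ℝ → X) × X => edist (p.1 q) (p.1 a)) +
                    fun p : (ℝ → X) × X => edist (p.1 a) p.2) p ^ (2 : ℝ) ∂Q) ^ (1 / (2 : ℝ)) := by
                  gcongr with p
                  exact edist_triangle _ _ _
              _ ≤ _ := ENNReal.lintegral_Lp_add_le (by fun_prop) (by fun_prop) (by norm_num)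
              _ ≤ (ENNReal.ofReal (a - q) * W + δ / 2) + (ENNReal.ofReal (r - a) * W + δ / 2) :=
                  add_le_add (hd' q hq a haF hqa) hcost'
              _ = ENNReal.ofReal (r - q) * W + δ := by
                  rw [show r - q = (a - q) + (r - a) by ring,
                    ENNReal.ofReal_add (by linarith) (by linarith), add_mul]
                  nth_rw 3 [← ENNReal.add_halves δ]
                  abel
        · rcases Finset.mem_insert.1 hq with rfl | hq
          · exact absurd (hb r ‹_›) (not_lt.2 hqr)
          · simp only [old q hq, old r hr]
            refine (hd' q hq r hr hqr).trans ?_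
            gcongr
            exact ENNReal.half_le_self

end NegCD

/-! ### Almost optimal chains are almost geodesic -/

namespace NegCD

open ProbabilityTheory Filter Topology

/-- If `u + v = D`, then `b u² + a v² = (u - a D)² + a b D²`, so the excess over `a b D²` measures
how far `u` is from its share `a D`. The weaker factor `b` on that square is what keeps the
inequality true when `u > D`. -/
theorem sq_sub_mul_add_le {a b u v D : ℝ} (ha : 0 ≤ a) (hb : 0 ≤ b) (hab : a + b = 1)
    (hD : 0 ≤ D) (h : D ≤ u + v) :
    b * (u - a * D) ^ 2 + a * b * D ^ 2 ≤ b * u ^ 2 + a * v ^ 2 := by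
  obtain rfl : b = 1 - a := by linarith
  rcases le_total D u with h1 | h1
  · nlinarith [mul_nonneg (mul_nonneg ha hb) (mul_nonneg hD (sub_nonneg.2 h1)), sq_nonneg v,
      mul_nonneg ha (sq_nonneg v), mul_nonneg (mul_nonneg ha hb) (mul_nonneg ha (sq_nonneg D)),
      mul_nonneg (mul_nonneg ha hb) (mul_nonneg hb (sq_nonneg D))]
  · have h2 : (D - u) ^ 2 ≤ v ^ 2 := pow_le_pow_left₀ (by linarith) (by linarith) 2
    nlinarith [mul_nonneg ha (sub_nonneg.2 h2), mul_nonneg ha (sq_nonneg (u - a * D))]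

variable {X : Type*} [MetricSpace X] [MeasurableSpace X] [BorelSpace X]
  [SecondCountableTopology X]

theorem lintegral_sq_le_of_rpow_le {Ω : Type*} [MeasurableSpace Ω] {P : Measure Ω}
    {f : Ω → ℝ≥0∞} {c : ℝ≥0∞} (h : (∫⁻ ω, f ω ^ (2 : ℝ) ∂P) ^ (1 / (2 : ℝ)) ≤ c) :
    ∫⁻ ω, f ω ^ 2 ∂P ≤ c ^ 2 := by
  have := ENNReal.rpow_le_rpow h (z := 2) (by norm_num)
  rw [← ENNReal.rpow_mul] at this
  simpa using this

/-- Chebyshev's inequality for a chain of almost optimal couplings: the distances are almost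
those along a minimal geodesic. -/
theorem measure_chain_defect_le {P : Measure (ℝ → X)}
    {F : Finset ℝ} {w δ : ℝ} (hw : 0 ≤ w) (hδ : 0 ≤ δ) (hδ1 : δ ≤ 1)
    (hd : ∀ q ∈ F, ∀ r ∈ F, q ≤ r →
        (∫⁻ ω, edist (ω q) (ω r) ^ (2 : ℝ) ∂P) ^ (1 / (2 : ℝ)) ≤
          ENNReal.ofReal (r - q) * ENNReal.ofReal w + ENNReal.ofReal δ)
    (hWle : ENNReal.ofReal w ^ 2 ≤ ∫⁻ ω, edist (ω 0) (ω 1) ^ 2 ∂P)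
    (h0 : 0 ∈ F) (h1 : 1 ∈ F) {q r : ℝ} (hq : q ∈ F) (hr : r ∈ F) (hq0 : 0 ≤ q) (hr1 : r ≤ 1)
    (hqr : q ≤ r) (hqr1 : r - q < 1) {η : ℝ} (hη : 0 < η) :
    P {ω | η < |dist (ω q) (ω r) - (r - q) * dist (ω 0) (ω 1)|} ≤
      ENNReal.ofReal (δ * ((6 * w + 5) / ((1 - (r - q)) * η ^ 2))) := by
  set a := r - q with ha
  have ha0 : 0 ≤ a := sub_nonneg.2 hqr
  have hb : 0 < 1 - a := by linarith
  set u : (ℝ → X) → ℝ := fun ω => dist (ω q) (ω r)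
  set v : (ℝ → X) → ℝ := fun ω => dist (ω 0) (ω q) + dist (ω r) (ω 1)
  set D : (ℝ → X) → ℝ := fun ω => dist (ω 0) (ω 1)
  have hum : Measurable u := by fun_prop
  have hvm : Measurable v := by fun_prop
  have hDm : Measurable D := by fun_prop
  have hU : ∫⁻ ω, ENNReal.ofReal (u ω ^ 2) ∂P ≤ ENNReal.ofReal ((a * w + δ) ^ 2) := by
    rw [ENNReal.ofReal_pow (by positivity), ENNReal.ofReal_add (by positivity) hδ,
      ENNReal.ofReal_mul ha0]
    convert lintegral_sq_le_of_rpow_le (hd q hq r hr hqr) using 3 with ω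
    rw [edist_dist, ENNReal.ofReal_pow dist_nonneg]
  have hV : ∫⁻ ω, ENNReal.ofReal (v ω ^ 2) ∂P ≤ ENNReal.ofReal (((1 - a) * w + 2 * δ) ^ 2) := by
    rw [ENNReal.ofReal_pow (by positivity)]
    have key : (∫⁻ ω, (edist (ω 0) (ω q) + edist (ω r) (ω 1)) ^ (2 : ℝ) ∂P) ^ (1 / (2 : ℝ)) ≤
        ENNReal.ofReal ((1 - a) * w + 2 * δ) := by
      refine (ENNReal.lintegral_Lp_add_le (by fun_prop) (by fun_prop) (by norm_num)).trans ?_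
      refine (add_le_add (hd 0 h0 q hq hq0) (hd r hr 1 h1 hr1)).trans (le_of_eq ?_)
      rw [← ENNReal.ofReal_mul (by linarith), ← ENNReal.ofReal_mul (by linarith),
        ← ENNReal.ofReal_add (by nlinarith) hδ, ← ENNReal.ofReal_add (by nlinarith) hδ,
        ← ENNReal.ofReal_add (by nlinarith) (by nlinarith)]
      congr 1
      rw [ha]; ring
    convert lintegral_sq_le_of_rpow_le key using 3 with ω
    rw [edist_dist, edist_dist, ← ENNReal.ofReal_add dist_nonneg dist_nonneg,
      ENNReal.ofReal_pow (by positivity)]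
  have hE : ENNReal.ofReal (w ^ 2) ≤ ∫⁻ ω, ENNReal.ofReal (D ω ^ 2) ∂P := by
    rw [ENNReal.ofReal_pow hw]
    convert hWle using 3 with ω
    rw [edist_dist, ENNReal.ofReal_pow dist_nonneg]
  set I := ∫⁻ ω, ENNReal.ofReal ((u ω - a * D ω) ^ 2) ∂P with hI
  have hsum : ENNReal.ofReal (1 - a) * I + ENNReal.ofReal (a * (1 - a) * w ^ 2) ≤
      ENNReal.ofReal ((1 - a) * (a * w + δ) ^ 2 + a * ((1 - a) * w + 2 * δ) ^ 2) := by
    have hab : 0 ≤ a * (1 - a) := by positivity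
    calc _ ≤ ENNReal.ofReal (1 - a) * I +
          ENNReal.ofReal (a * (1 - a)) * ∫⁻ ω, ENNReal.ofReal (D ω ^ 2) ∂P := by
          rw [ENNReal.ofReal_mul hab]
          gcongr
      _ = ∫⁻ ω, (ENNReal.ofReal (1 - a) * ENNReal.ofReal ((u ω - a * D ω) ^ 2) +
          ENNReal.ofReal (a * (1 - a)) * ENNReal.ofReal (D ω ^ 2)) ∂P := by
          rw [lintegral_add_left (by fun_prop), lintegral_const_mul _ (by fun_prop),
            lintegral_const_mul _ (by fun_prop)]
      _ ≤ ∫⁻ ω, (ENNReal.ofReal (1 - a) * ENNReal.ofReal (u ω ^ 2) +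
          ENNReal.ofReal a * ENNReal.ofReal (v ω ^ 2)) ∂P := by
          refine lintegral_mono fun ω => ?_
          rw [← ENNReal.ofReal_mul hb.le, ← ENNReal.ofReal_mul hab, ← ENNReal.ofReal_mul hb.le,
            ← ENNReal.ofReal_mul ha0, ← ENNReal.ofReal_add (by positivity) (by positivity),
            ← ENNReal.ofReal_add (by positivity) (by positivity)]
          refine ENNReal.ofReal_le_ofReal (sq_sub_mul_add_le ha0 hb.le (by ring) dist_nonneg ?_)
          have h1 := dist_triangle (ω 0) (ω q) (ω 1)
          have h2 := dist_triangle (ω q) (ω r) (ω 1)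
          simp only [D, u, v]
          linarith
      _ = ENNReal.ofReal (1 - a) * ∫⁻ ω, ENNReal.ofReal (u ω ^ 2) ∂P +
          ENNReal.ofReal a * ∫⁻ ω, ENNReal.ofReal (v ω ^ 2) ∂P := by
          rw [lintegral_add_left (by fun_prop), lintegral_const_mul _ (by fun_prop),
            lintegral_const_mul _ (by fun_prop)]
      _ ≤ _ := by
          rw [ENNReal.ofReal_add (by positivity) (by positivity), ENNReal.ofReal_mul hb.le,
            ENNReal.ofReal_mul ha0]
          gcongr
  have hIle : I ≤ ENNReal.ofReal (δ * ((6 * w + 5) / (1 - a))) := by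
    have hfin : I ≠ ∞ := by
      intro h
      rw [h, ENNReal.mul_top (by simpa using hb), top_add, top_le_iff] at hsum
      exact ENNReal.ofReal_ne_top hsum
    clear_value I
    lift I to NNReal using hfin
    rw [← ENNReal.ofReal_coe_nnreal, ← ENNReal.ofReal_mul hb.le,
      ← ENNReal.ofReal_add (by positivity) (by positivity),
      ENNReal.ofReal_le_ofReal_iff (by positivity)] at hsum
    rw [← ENNReal.ofReal_coe_nnreal]
    refine ENNReal.ofReal_le_ofReal ?_
    -- In `(1 - a)(a w + δ)² + a((1 - a) w + 2δ)²` the `w²` terms sum to exactly `a(1 - a) w²` and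
    -- cancel. What is left is `6a(1 - a)wδ + (1 + 3a)δ²`, at most `δ(6w + 5)` because `δ ≤ 1`.
    rw [mul_div_assoc', le_div_iff₀ hb]
    have e1 : δ ^ 2 ≤ δ := by nlinarith
    have e2 : 0 ≤ w * δ := by positivity
    have e3 : a * (1 - a) ≤ 1 := by nlinarith
    nlinarith [mul_nonneg e2 (sub_nonneg.2 e3), mul_nonneg hb.le (sub_nonneg.2 e1),
      mul_nonneg ha0 (sub_nonneg.2 e1), mul_nonneg ha0 hδ]
  calc P {ω | η < |u ω - a * D ω|}
      ≤ P {ω | ENNReal.ofReal (η ^ 2) ≤ ENNReal.ofReal ((u ω - a * D ω) ^ 2)} := by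
        refine measure_mono fun ω hω => ?_
        simp only [mem_ofPred_eq] at hω ⊢
        rw [← sq_abs (u ω - a * D ω)]
        gcongr
    _ ≤ I / ENNReal.ofReal (η ^ 2) :=
        meas_ge_le_lintegral_div (by fun_prop) (by simpa using hη.ne') ENNReal.ofReal_ne_top
    _ ≤ ENNReal.ofReal (δ * ((6 * w + 5) / (1 - a))) / ENNReal.ofReal (η ^ 2) := by gcongr
    _ = _ := by
        rw [← ENNReal.ofReal_div_of_pos (by positivity)]
        congr 1
        field_simp

/-- The Chebyshev bound for each pair of times is proportional to `δ`. With `F` and `η` fixed, a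
small `δ` brings it below `ε` divided by the number of pairs, and a union bound finishes. -/
theorem exists_almost_geodesic_chain [StandardBorelSpace X]
    (μ : ℝ → Measure X) (hW : W2 (μ 0) (μ 1) ≠ ∞) (F : Finset ℝ) (hF : ∀ q ∈ F, q ∈ Icc (0 : ℝ) 1)
    (h0 : 0 ∈ F) (h1 : 1 ∈ F) (hμ : IsW2Geodesic μ) {η : ℝ} (hη : 0 < η) {ε : ℝ≥0∞} (hε : ε ≠ 0) :
    ∃ P : Measure (ℝ → X), IsProbabilityMeasure P ∧ (∀ q ∈ F, P.map (fun ω => ω q) = μ q) ∧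
      P {ω | ∃ q ∈ F, ∃ r ∈ F,
        η < |dist (ω q) (ω r) - |q - r| * dist (ω 0) (ω 1)|} ≤ ε := by
  set w := (W2 (μ 0) (μ 1)).toReal with hw
  have hwW : ENNReal.ofReal w = W2 (μ 0) (μ 1) := ENNReal.ofReal_toReal hW
  have hw0 : 0 ≤ w := ENNReal.toReal_nonneg
  have hε' : ε / (F.card * F.card) ≠ 0 := by
    refine ENNReal.div_ne_zero.2 ⟨hε, ?_⟩
    finiteness
  have hev : ∀ᶠ δ in 𝓝[>] (0 : ℝ), ∀ q ∈ F, ∀ r ∈ F,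
      ENNReal.ofReal (δ * ((6 * w + 5) / ((1 - (r - q)) * η ^ 2))) ≤ ε / (F.card * F.card) := by
    rw [eventually_all_finset]
    intro q _
    rw [eventually_all_finset]
    intro r _
    have : Tendsto (fun δ : ℝ => ENNReal.ofReal (δ * ((6 * w + 5) / ((1 - (r - q)) * η ^ 2))))
        (𝓝[>] 0) (𝓝 0) := by
      have : Continuous fun δ : ℝ =>
        ENNReal.ofReal (δ * ((6 * w + 5) / ((1 - (r - q)) * η ^ 2))) :=
      ENNReal.continuous_ofReal.comp (continuous_id.mul continuous_const)
      simpa using (this.tendsto 0).mono_left nhdsWithin_le_nhds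
    exact this.eventually_le_const (pos_iff_ne_zero.2 hε')
  obtain ⟨δ, hδ, hδ1, (hδ0 : 0 < δ)⟩ := (hev.and ((eventually_le_nhds zero_lt_one).filter_mono
    nhdsWithin_le_nhds |>.and (eventually_mem_nhdsWithin (a := (0 : ℝ)) (s := Ioi 0)))).exists
  obtain ⟨P, hP, hm, hd⟩ := exists_chain μ hW F ⟨0, h0⟩ (fun q hq => (hμ.1 q (hF q hq)).1)
    (fun q hq r hr hqr => by
      rw [hμ.2 q (hF q hq) r (hF r hr), abs_sub_comm, abs_of_nonneg (sub_nonneg.2 hqr)])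
    (δ := ENNReal.ofReal δ) (by simpa using hδ0)
  refine ⟨P, hP, hm, ?_⟩
  -- The endpoints of the random path form a coupling of `μ 0` and `μ 1`, so their cost cannot be
  -- smaller than the Wasserstein distance.
  have hWle : ENNReal.ofReal w ^ 2 ≤ ∫⁻ ω, edist (ω 0) (ω 1) ^ 2 ∂P := by
    have hc : IsCoupling (μ 0) (μ 1) (P.map fun ω => (ω 0, ω 1)) := by
      constructor
      · rw [Measure.map_map (by fun_prop) (by fun_prop), ← hm 0 h0]; rfl
      · rw [Measure.map_map (by fun_prop) (by fun_prop), ← hm 1 h1]; rfl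
    have : W2 (μ 0) (μ 1) ≤ transportCost (P.map fun ω => (ω 0, ω 1)) := iInf₂_le _ hc
    rw [transportCost, lintegral_map (by fun_prop) (by fun_prop)] at this
    rw [hwW]
    have := ENNReal.rpow_le_rpow this (z := 2) (by norm_num)
    rw [← ENNReal.rpow_mul] at this
    simpa using this
  have pair : ∀ q ∈ F, ∀ r ∈ F, q ≤ r →
      P {ω | η < |dist (ω q) (ω r) - (r - q) * dist (ω 0) (ω 1)|} ≤ ε / (F.card * F.card) := by
    intro q hq r hr hqr
    rcases lt_or_ge (r - q) 1 with h | h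
    · rw [← hwW] at hd
      exact (measure_chain_defect_le hw0 hδ0.le hδ1 hd hWle h0 h1 hq hr (hF q hq).1 (hF r hr).2
        hqr h hη).trans (hδ q hq r hr)
    -- The Chebyshev bound degenerates when `r - q = 1`, but then the pair is `(0, 1)` and the
    -- defect vanishes identically.
    · obtain rfl : q = 0 := by linarith [(hF q hq).1, (hF r hr).2]
      obtain rfl : r = 1 := by linarith [(hF r hr).2]
      simp [hη.not_gt]
  calc _ ≤ P (⋃ q ∈ F, ⋃ r ∈ F, {ω | η < |dist (ω q) (ω r) - |q - r| * dist (ω 0) (ω 1)|}) := by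
        refine measure_mono fun ω hω => ?_
        simpa using hω
    _ ≤ ∑ q ∈ F, ∑ r ∈ F, P {ω | η < |dist (ω q) (ω r) - |q - r| * dist (ω 0) (ω 1)|} :=
        (measure_biUnion_finset_le _ _).trans
          (Finset.sum_le_sum fun q _ => measure_biUnion_finset_le _ _)
    _ ≤ ∑ q ∈ F, ∑ r ∈ F, ε / (F.card * F.card) := by
        refine Finset.sum_le_sum fun q hq => Finset.sum_le_sum fun r hr => ?_
        rcases le_total q r with h | h
        · rw [abs_sub_comm q r, abs_of_nonneg (sub_nonneg.2 h)]
          exact pair q hq r hr h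
        · rw [abs_of_nonneg (sub_nonneg.2 h)]
          simpa only [dist_comm] using pair r hr q hq h
    _ ≤ ε := by
        simp only [Finset.sum_const, nsmul_eq_mul]
        rw [← mul_assoc]
        exact ENNReal.mul_div_le

end NegCD

/-! ### From almost geodesic chains to minimal geodesics -/

namespace NegCD

open ProbabilityTheory Filter Topology

variable {X : Type*} [MetricSpace X]

/-- A geodesic defined on a dense sequence of times extends to `[0,1]`. -/
theorem exists_isMinimalGeodesic_of_dense [CompleteSpace X] {e : ℕ → ℝ} (h0 : e 0 = 0)
    (h1 : e 1 = 1) (hd : ∀ s ∈ Icc (0 : ℝ) 1, s ∈ closure (range e)) (he : ∀ i, e i ∈ Icc (0 : ℝ) 1)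
    {x : ℕ → X} (hx : ∀ i j, dist (x i) (x j) = |e i - e j| * dist (x 0) (x 1)) :
    ∃ γ : ℝ → X, IsMinimalGeodesic γ ∧ ∀ i, γ (e i) = x i := by
  have hne : ∀ s ∈ Icc (0 : ℝ) 1, (comap e (𝓝 s)).NeBot := fun s hs => by
    rw [comap_neBot_iff]
    intro u hu
    obtain ⟨_, hy, i, rfl⟩ := mem_closure_iff_nhds.1 (hd s hs) u hu
    exact ⟨i, hy⟩
  have hdist : ∀ s r, Tendsto (fun p : ℕ × ℕ => dist (x p.1) (x p.2))
      (comap e (𝓝 s) ×ˢ comap e (𝓝 r)) (𝓝 (|s - r| * dist (x 0) (x 1))) := by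
    intro s r
    exact (((tendsto_comap.comp tendsto_fst).sub
      (tendsto_comap.comp tendsto_snd)).abs.mul_const _).congr fun p => (hx p.1 p.2).symm
  have hlim : ∀ s, ∃ y, s ∈ Icc (0 : ℝ) 1 → Tendsto x (comap e (𝓝 s)) (𝓝 y) := by
    intro s
    by_cases hs : s ∈ Icc (0 : ℝ) 1
    · have := hne s hs
      have hc : Cauchy (map x (comap e (𝓝 s))) := by
        rw [cauchy_map_iff', tendsto_uniformity_iff_dist_tendsto_zero]
        simpa using hdist s s
      obtain ⟨y, hy⟩ := CompleteSpace.complete hc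
      exact ⟨y, fun _ => hy⟩
    · exact ⟨x 0, fun h => absurd h hs⟩
  choose γ hγ using hlim
  have hval : ∀ i, γ (e i) = x i := by
    intro i
    have h : pure i ≤ comap e (𝓝 (e i)) := tendsto_iff_comap.1 (tendsto_pure_nhds e i)
    exact tendsto_nhds_unique ((hγ _ (he i)).mono_left h) (tendsto_pure_nhds x i)
  refine ⟨γ, ?_, hval⟩
  intro s hs r hr
  have := hne s hs
  have := hne r hr
  rw [← h0, ← h1, hval, hval]
  exact tendsto_nhds_unique
    (((hγ s hs).comp tendsto_fst).dist ((hγ r hr).comp tendsto_snd)) (hdist s r)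

/-- The times `0, 1, t`, followed by a dense sequence in `[0,1]`. -/
theorem exists_dense_times {t : ℝ} (ht : t ∈ Icc (0 : ℝ) 1) :
    ∃ e : ℕ → ℝ, e 0 = 0 ∧ e 1 = 1 ∧ e 2 = t ∧ (∀ i, e i ∈ Icc (0 : ℝ) 1) ∧
      ∀ s ∈ Icc (0 : ℝ) 1, s ∈ closure (range e) := by
  let D := TopologicalSpace.denseSeq (Icc (0 : ℝ) 1)
  refine ⟨fun i => match i with | 0 => 0 | 1 => 1 | 2 => t | n + 3 => D n, rfl, rfl, rfl, ?_, ?_⟩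
  · rintro (_ | _ | _ | n)
    · simp
    · simp
    · exact ht
    · exact (D n).2
  · intro s hs
    have h1 : (⟨s, hs⟩ : Icc (0 : ℝ) 1) ∈ closure (range D) :=
      TopologicalSpace.denseRange_denseSeq _ _
    have h2 := image_closure_subset_closure_image continuous_subtype_val (mem_image_of_mem _ h1)
    refine closure_mono ?_ h2
    rintro _ ⟨_, ⟨n, rfl⟩, rfl⟩
    exact ⟨n + 3, rfl⟩

variable [MeasurableSpace X] [BorelSpace X]

/-- Along a Wasserstein geodesic, mass is transported along minimal geodesics. -/
theorem IsW2Geodesic.exists_subset_intermediateSet [CompleteSpace X] [SecondCountableTopology X]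
    {μ : ℝ → Measure X} (hμ : IsW2Geodesic μ) (hW : W2 (μ 0) (μ 1) ≠ ∞)
    {B₀ B₁ : Set X} (hB₀ : MeasurableSet B₀) (hB₁ : MeasurableSet B₁) (h₀ : μ 0 B₀ᶜ = 0)
    (h₁ : μ 1 B₁ᶜ = 0) {t : ℝ} (ht : t ∈ Icc (0 : ℝ) 1) {ε : ℝ≥0∞} (hε : ε ≠ 0) (hε1 : ε < 1) :
    ∃ E ⊆ intermediateSet B₀ B₁ t, MeasurableSet E ∧ μ t Eᶜ ≤ ε := by
  obtain ⟨e, e0, e1, e2, he, hdense⟩ := exists_dense_times ht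
  have hε2 : ε / 2 ≠ 0 := by simpa using hε
  obtain ⟨ε', hε'0, hε'⟩ := ENNReal.exists_pos_sum_of_countable' hε2 ℕ
  have hB : ∀ i, ∃ B, MeasurableSet B ∧ μ (e i) Bᶜ = 0 ∧ (i = 0 → B ⊆ B₀) ∧ (i = 1 → B ⊆ B₁) := by
    rintro (_ | _ | i)
    · exact ⟨B₀, hB₀, by rwa [e0], by simp, by simp⟩
    · exact ⟨B₁, hB₁, by simpa [e1] using h₁, by simp, by simp⟩
    · exact ⟨univ, by simp, by simp, by simp, by simp⟩
  have hC : ∀ i, ∃ C, IsCompact C ∧ C.Nonempty ∧ μ (e i) Cᶜ ≤ ε' i ∧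
      (i = 0 → C ⊆ B₀) ∧ (i = 1 → C ⊆ B₁) := by
    intro i
    obtain ⟨B, hBm, hBn, hBs⟩ := hB i
    have := (hμ.1 (e i) (he i)).1
    obtain ⟨C, hCB, hC, hlt⟩ := hBm.exists_isCompact_sdiff_lt (μ := μ (e i)) (measure_ne_top _ _)
      (hε'0 i).ne'
    have hle : μ (e i) Cᶜ ≤ ε' i := by
      calc μ (e i) Cᶜ ≤ μ (e i) (Bᶜ ∪ B \ C) := by
            refine measure_mono fun z hz => ?_
            by_cases h : z ∈ B
            · exact Or.inr ⟨h, hz⟩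
            · exact Or.inl h
        _ ≤ μ (e i) Bᶜ + μ (e i) (B \ C) := measure_union_le _ _
        _ ≤ ε' i := by rw [hBn, zero_add]; exact hlt.le
    refine ⟨C, hC, ?_, hle, fun h => hCB.trans (hBs.1 h), fun h => hCB.trans (hBs.2 h)⟩
    -- Nonemptiness uses `ε < 1`: an empty compact set would miss the whole mass. The points are
    -- needed below as filler coordinates.
    by_contra hCe
    rw [not_nonempty_iff_eq_empty] at hCe
    rw [hCe, compl_empty, measure_univ] at hle
    have : ε' i ≤ ε / 2 := (ENNReal.le_tsum i).trans hε'.le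
    exact absurd (hle.trans (this.trans ENNReal.half_le_self)) (not_le.2 hε1)
  choose C hCc hCne hCμ hC0 hC1 using hC
  -- Sequences in the compact product that are geodesic up to `1 / (n + 1)` at the first `n + 3`
  -- times. The offset `3` ensures that `0`, `1` and `t` always take part.
  let G : ℕ → Set (ℕ → X) := fun n => univ.pi C ∩ {x | ∀ i < n + 3, ∀ j < n + 3,
    |dist (x i) (x j) - |e i - e j| * dist (x 0) (x 1)| ≤ 1 / ((n : ℝ) + 1)}
  have hGc : ∀ n, IsCompact (G n) := by
    intro n
    refine (isCompact_univ_pi hCc).inter_right ?_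
    simp only [ofPred_forall]
    refine isClosed_iInter fun i => isClosed_iInter fun _ => isClosed_iInter fun j =>
      isClosed_iInter fun _ => ?_
    exact isClosed_le (by fun_prop) continuous_const
  have hGanti : Antitone G := by
    rintro n k hnk x ⟨hx1, hx2⟩
    refine ⟨hx1, fun i hi j hj => (hx2 i (by lia) j (by lia)).trans ?_⟩
    gcongr
  let E : ℕ → Set X := fun n => (fun x : ℕ → X => x 2) '' G n
  have hEm : ∀ n, MeasurableSet (E n) := fun n =>
    ((hGc n).image (continuous_apply 2)).isClosed.measurableSet
  have hEμ : ∀ n, μ t (E n)ᶜ ≤ ε := by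
    intro n
    -- The random path is indexed by times rather than by indices, so repetitions in `e`, as when
    -- `t` is `0` or `1`, do no harm.
    let F : Finset ℝ := (Finset.range (n + 3)).image e
    have hF : ∀ i < n + 3, e i ∈ F := fun i hi => Finset.mem_image_of_mem e (by simpa using hi)
    have hXne : Nonempty X := ⟨(hCne 0).some⟩
    obtain ⟨P, hP, hm, hbad⟩ := exists_almost_geodesic_chain μ hW F
      (by
        intro q hq
        obtain ⟨i, -, rfl⟩ := Finset.mem_image.1 hq
        exact he i)
      (by simpa [e0] using hF 0 (by lia)) (by simpa [e1] using hF 1 (by lia)) hμ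
      (η := 1 / ((n : ℝ) + 1)) (by positivity) hε2
    have htF : t ∈ F := by simpa [e2] using hF 2 (by lia)
    calc μ t (E n)ᶜ = P {ω | ω t ∉ E n} := by
          rw [← hm t htF, Measure.map_apply (by fun_prop) (hEm n).compl]
          rfl
      _ ≤ P ({ω | ∃ q ∈ F, ∃ r ∈ F,
            1 / ((n : ℝ) + 1) < |dist (ω q) (ω r) - |q - r| * dist (ω 0) (ω 1)|} ∪
            ⋃ i ∈ Finset.range (n + 3), {ω | ω (e i) ∉ C i}) := by
          refine measure_mono fun ω hω => ?_
          by_contra hcon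
          simp only [mem_union, mem_ofPred_eq, mem_iUnion, not_or, not_exists, not_and, not_lt,
            Finset.mem_range, not_not] at hcon
          -- Off the exceptional event, the path sampled at the first `n + 3` times, completed by
          -- arbitrary points of the `C i`, lies in `G n`.
          refine hω ⟨fun i => if i < n + 3 then ω (e i) else (hCne i).some, ⟨?_, ?_⟩, ?_⟩
          · intro i _
            dsimp only
            split_ifs with hi
            · exact hcon.2 i hi
            · exact (hCne i).some_mem
          · intro i hi j hj
            have := hcon.1 (e i) (hF i hi) (e j) (hF j hj)
            simpa [hi, hj, e0, e1] using this
          · simp [e2]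
      _ ≤ ε / 2 + ∑ i ∈ Finset.range (n + 3), ε' i := by
          refine (measure_union_le _ _).trans (add_le_add hbad ?_)
          refine (measure_biUnion_finset_le _ _).trans (Finset.sum_le_sum fun i hi => ?_)
          refine le_trans (le_of_eq ?_) (hCμ i)
          rw [← hm (e i) (hF i (by simpa using hi)),
            Measure.map_apply (by fun_prop) (hCc i).isClosed.measurableSet.compl]
          rfl
      _ ≤ ε / 2 + ε / 2 := by
          gcongr
          exact (ENNReal.sum_le_tsum _).trans hε'.le
      _ = ε := ENNReal.add_halves ε
  refine ⟨⋂ n, E n, ?_, MeasurableSet.iInter hEm, ?_⟩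
  · intro z hz
    rw [mem_iInter] at hz
    have hclosed : IsClosed {x : ℕ → X | x 2 = z} :=
      isClosed_eq (continuous_apply 2) continuous_const
    -- Membership of `z` in each `E n` gives a witness depending on `n`; Cantor's intersection
    -- theorem yields one that serves all `n`, hence with no defect at all.
    obtain ⟨x, hx⟩ := IsCompact.nonempty_iInter_of_sequence_nonempty_isCompact_isClosed
      (fun n => G n ∩ {x | x 2 = z})
      (fun n => inter_subset_inter_left _ (hGanti n.le_succ))
      (fun n => by
        obtain ⟨x, hx, hxz⟩ := hz n
        exact ⟨x, hx, hxz⟩)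
      ((hGc 0).inter_right hclosed) (fun n => (hGc n).isClosed.inter hclosed)
    simp only [mem_iInter] at hx
    have hxd : ∀ i j, dist (x i) (x j) = |e i - e j| * dist (x 0) (x 1) := by
      intro i j
      rw [← sub_eq_zero, ← abs_nonpos_iff]
      refine ge_of_tendsto tendsto_one_div_add_atTop_nhds_zero_nat ?_
      filter_upwards [eventually_ge_atTop (max i j)] with n hn
      exact (hx n).1.2 i (by have := le_max_left i j; lia) j (by have := le_max_right i j; lia)
    obtain ⟨γ, hγ, hγe⟩ := exists_isMinimalGeodesic_of_dense e0 e1 hdense he hxd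
    refine ⟨γ, hγ, ?_, ?_, ?_⟩
    · rw [← e0, hγe]
      exact hC0 0 rfl ((hx 0).1.1 0 trivial)
    · rw [← e1, hγe]
      exact hC1 1 rfl ((hx 0).1.1 1 trivial)
    · rw [← e2, hγe]
      exact (hx 0).2
  · rw [compl_iInter]
    have hmono : Monotone fun n => (E n)ᶜ := fun n k h =>
      compl_subset_compl.2 (image_mono (hGanti h))
    rw [hmono.measure_iUnion]
    exact iSup_le hEμ

end NegCD

/-! ### From the entropy inequality to Brunn–Minkowski -/

namespace NegCD

open ProbabilityTheory Filter Topology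

theorem rpow_le_rpow_of_nonpos {x y : ℝ≥0∞} {z : ℝ} (hz : z ≤ 0) (h : x ≤ y) : y ^ z ≤ x ^ z := by
  rw [← neg_neg z, ENNReal.rpow_neg, ENNReal.rpow_neg x, ENNReal.inv_le_inv]
  exact ENNReal.rpow_le_rpow h (neg_nonneg.2 hz)

/-- Jensen's inequality on a set of finite positive measure. -/
theorem rpow_mul_rpow_le_lintegral {X : Type*} [MeasurableSpace X] (m : Measure X) {N : ℝ}
    (hN : N < 0) {E : Set X} (hE0 : m E ≠ 0) (hET : m E ≠ ∞) {ρ : X → ℝ≥0∞} (hρ : Measurable ρ) :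
    (∫⁻ x in E, ρ x ∂m) ^ ((N - 1) / N) * m E ^ (1 / N) ≤ ∫⁻ x, ρ x ^ ((N - 1) / N) ∂m := by
  have hp : (N - 1) / N = 1 - 1 / N := by rw [sub_div, div_self hN.ne]
  have hN' : 1 / N < 0 := by simpa using hN
  have hpq : ((N - 1) / N).HolderConjugate (1 - N) := by
    rw [Real.holderConjugate_iff]
    refine ⟨by rw [hp]; linarith, ?_⟩
    have : 1 - N ≠ 0 := by linarith
    have : N - 1 ≠ 0 := by linarith
    field_simp
    ring
  have hH := ENNReal.lintegral_mul_le_Lp_mul_Lq (m.restrict E) hpq hρ.aemeasurable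
    (aemeasurable_const (b := (1 : ℝ≥0∞)))
  simp only [Pi.mul_apply, mul_one, ENNReal.one_rpow, lintegral_const, Measure.restrict_apply,
    MeasurableSet.univ, univ_inter, one_mul] at hH
  have hH2 := ENNReal.rpow_le_rpow hH hpq.nonneg
  rw [ENNReal.mul_rpow_of_nonneg _ _ hpq.nonneg, ← ENNReal.rpow_mul, ← ENNReal.rpow_mul,
    one_div_mul_cancel hpq.ne_zero, ENNReal.rpow_one] at hH2
  have he : 1 / (1 - N) * ((N - 1) / N) = -(1 / N) := by
    have : 1 - N ≠ 0 := by linarith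
    field_simp
    ring
  rw [he] at hH2
  calc _ ≤ (∫⁻ x in E, ρ x ^ ((N - 1) / N) ∂m) * m E ^ (-(1 / N)) * m E ^ (1 / N) := by gcongr
    _ = ∫⁻ x in E, ρ x ^ ((N - 1) / N) ∂m := by
      -- The two powers of `m E` cancel only because `m E` is neither `0` nor `∞`.
      rw [mul_assoc, ← ENNReal.rpow_add _ _ hE0 hET]
      simp
    _ ≤ _ := setLIntegral_le_lintegral _ _

theorem intermediateSet_mono {X : Type*} [MetricSpace X] {A₀ A₁ B₀ B₁ : Set X} (h₀ : B₀ ⊆ A₀)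
    (h₁ : B₁ ⊆ A₁) (t : ℝ) :
    intermediateSet B₀ B₁ t ⊆ intermediateSet A₀ A₁ t :=
  fun _ ⟨γ, hγ, h0, h1, h⟩ => ⟨γ, hγ, h₀ h0, h₁ h1, h⟩

theorem rnDeriv_uniform {X : Type*} [MeasurableSpace X] (m : Measure X) [SigmaFinite m]
    {B : Set X} (hB : MeasurableSet B) :
    (m.withDensity (B.indicator fun _ => (m B)⁻¹)).rnDeriv m =ᵐ[m] B.indicator fun _ => (m B)⁻¹ :=
  Measure.rnDeriv_withDensity _ (measurable_const.indicator hB)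

theorem withDensity_uniform_compl {X : Type*} [MeasurableSpace X] (m : Measure X) {B : Set X}
    (hB : MeasurableSet B) :
    m.withDensity (B.indicator fun _ => (m B)⁻¹) Bᶜ = 0 := by
  rw [withDensity_indicator hB, withDensity_const, Measure.smul_apply,
    Measure.restrict_apply hB.compl]
  simp

variable {X : Type*} [MetricSpace X] [MeasurableSpace X]

theorem isP2_uniform (m : Measure X) {B : Set X} (hB : MeasurableSet B)
    (h0 : m B ≠ 0) (hT : m B ≠ ∞) (hd : Metric.ediam B ≠ ∞) :
    IsP2 (m.withDensity (B.indicator fun _ => (m B)⁻¹)) := by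
  have hP : IsProbabilityMeasure (m.withDensity (B.indicator fun _ => (m B)⁻¹)) := by
    constructor
    rw [withDensity_indicator hB, withDensity_const, Measure.smul_apply,
      Measure.restrict_apply_univ, smul_eq_mul, ENNReal.inv_mul_cancel h0 hT]
  refine ⟨hP, ?_⟩
  obtain ⟨x₀, hx₀⟩ := nonempty_of_measure_ne_zero h0
  refine ⟨x₀, ?_⟩
  calc _ ≤ ∫⁻ _, Metric.ediam B ^ 2 ∂(m.withDensity (B.indicator fun _ => (m B)⁻¹)) := by
        refine lintegral_mono_ae ?_
        filter_upwards [measure_eq_zero_iff_ae_notMem.1 (withDensity_uniform_compl m hB)] with x hx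
        gcongr
        exact Metric.edist_le_ediam_of_mem (not_not.1 hx) hx₀
    _ < ∞ := by
        rw [lintegral_const, measure_univ, mul_one]
        exact ENNReal.pow_lt_top (lt_top_iff_ne_top.2 hd)

/-- The Brunn–Minkowski inequality for bounded sets of positive finite measure. -/
theorem CurvDimWith.brunnMinkowski_of_bounded [BorelSpace X] [CompleteSpace X]
    [SecondCountableTopology X] {m : Measure X} [SigmaFinite m] {N : ℝ} (hN : N < 0)
    {β : ℝ → ℝ → ℝ → ℝ≥0∞} (h : CurvDimWith β N m) {B₀ B₁ : Set X}
    (hB₀ : MeasurableSet B₀) (hB₁ : MeasurableSet B₁) (h₀ : m B₀ ≠ 0) (h₁ : m B₁ ≠ 0) (h₀T : m B₀ ≠ ∞) (h₁T : m B₁ ≠ ∞)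
    (hd : Metric.ediam (B₀ ∪ B₁) ≠ ∞) {t : ℝ} (ht : t ∈ Icc (0 : ℝ) 1) {T₀ T₁ : ℝ≥0∞}
    (hT₀ : T₀ ≠ ∞) (hT₁ : T₁ ≠ ∞) (hβ₀ : ∀ x ∈ B₀, ∀ y ∈ B₁, β N (1 - t) (dist x y) ≤ T₀)
    (hβ₁ : ∀ x ∈ B₀, ∀ y ∈ B₁, β N t (dist x y) ≤ T₁) :
    m (intermediateSet B₀ B₁ t) ^ (1 / N) ≤ T₀ * m B₀ ^ (1 / N) + T₁ * m B₁ ^ (1 / N) := by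
  set R := T₀ * m B₀ ^ (1 / N) + T₁ * m B₁ ^ (1 / N) with hR
  have hRT : R ≠ ∞ := by
    refine ENNReal.add_ne_top.2 ⟨ENNReal.mul_ne_top hT₀ ?_, ENNReal.mul_ne_top hT₁ ?_⟩
    · exact ENNReal.rpow_ne_top_of_ne_zero h₀ h₀T
    · exact ENNReal.rpow_ne_top_of_ne_zero h₁ h₁T
  obtain ⟨μ, π, hμ, hμ0, hμ1, hπ, hS⟩ := h _ _
    (isP2_uniform m hB₀ h₀ h₀T (ne_top_of_le_ne_top hd (Metric.ediam_mono subset_union_left)))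
    (isP2_uniform m hB₁ h₁ h₁T (ne_top_of_le_ne_top hd (Metric.ediam_mono subset_union_right)))
    (withDensity_absolutelyContinuous _ _) (withDensity_absolutelyContinuous _ _)
  have hP0 := (hμ.1 0 (by simp)).1
  rw [hμ0] at hP0
  have hπP := hπ.1.isProbabilityMeasure
  have ae0 : ∀ {p : X → Prop}, (∀ᵐ x ∂(m.withDensity (B₀.indicator fun _ => (m B₀)⁻¹)), p x) →
      ∀ᵐ z ∂π, p z.1 := fun hp => ae_of_ae_map measurable_fst.aemeasurable (by rwa [hπ.1.1])
  have ae1 : ∀ {p : X → Prop}, (∀ᵐ x ∂(m.withDensity (B₁.indicator fun _ => (m B₁)⁻¹)), p x) →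
      ∀ᵐ z ∂π, p z.2 := fun hp => ae_of_ae_map measurable_snd.aemeasurable (by rwa [hπ.1.2])
  have mem0 : ∀ᵐ z ∂π, z.1 ∈ B₀ :=
    ae0 (by simpa using measure_eq_zero_iff_ae_notMem.1 (withDensity_uniform_compl m hB₀))
  have mem1 : ∀ᵐ z ∂π, z.2 ∈ B₁ :=
    ae1 (by simpa using measure_eq_zero_iff_ae_notMem.1 (withDensity_uniform_compl m hB₁))
  have dens0 := ae0 ((withDensity_absolutelyContinuous _ _).ae_le (rnDeriv_uniform m hB₀))
  have dens1 := ae1 ((withDensity_absolutelyContinuous _ _).ae_le (rnDeriv_uniform m hB₁))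
  have hW : W2 (μ 0) (μ 1) ≠ ∞ := by
    rw [hμ0, hμ1, ← hπ.2, transportCost]
    refine ENNReal.rpow_ne_top_of_nonneg (by norm_num) (ne_of_lt ?_)
    calc _ ≤ ∫⁻ _, Metric.ediam (B₀ ∪ B₁) ^ 2 ∂π := by
          refine lintegral_mono_ae ?_
          filter_upwards [mem0, mem1] with z hz0 hz1
          gcongr
          exact Metric.edist_le_ediam_of_mem (Or.inl hz0) (Or.inr hz1)
      _ < ∞ := by
          rw [lintegral_const, measure_univ, mul_one]
          exact ENNReal.pow_lt_top (lt_top_iff_ne_top.2 hd)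
  have hSR : renyiEntropy m N (μ t) ≤ R := by
    refine (hS t ht N ⟨le_rfl, hN⟩).trans ?_
    calc _ ≤ ∫⁻ _, R ∂π := by
          refine lintegral_mono_ae ?_
          filter_upwards [mem0, mem1, dens0, dens1] with z hz0 hz1 hd0 hd1
          rw [hd0, hd1, indicator_of_mem hz0, indicator_of_mem hz1, hR, ENNReal.inv_rpow,
            ENNReal.inv_rpow, ← ENNReal.rpow_neg, ← ENNReal.rpow_neg,
            show -(-1 / N) = 1 / N by ring]
          gcongr
          · exact hβ₀ _ hz0 _ hz1
          · exact hβ₁ _ hz0 _ hz1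
      _ = R := by rw [lintegral_const, measure_univ, mul_one]
  -- A finite entropy forces absolute continuity, since the entropy is `∞` by convention otherwise.
  have hac : μ t ≪ m := by
    by_contra hac
    rw [renyiEntropy, if_neg hac, top_le_iff] at hSR
    exact hRT hSR
  rw [renyiEntropy, if_pos hac] at hSR
  have hPt := (hμ.1 t ht).1
  -- Jensen needs subsets of finite measure; in the infinite case the left-hand side is `0`.
  by_cases hIT : m (intermediateSet B₀ B₁ t) = ∞
  · rw [hIT, ENNReal.top_rpow_of_neg (by simpa using hN)]
    exact zero_le
  have hp0 : 0 ≤ (N - 1) / N := by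
    rw [div_nonneg_iff]
    right
    constructor <;> linarith
  have key : ∀ ε : ℝ≥0∞, ε ≠ 0 → ε < 1 →
      (1 - ε) ^ ((N - 1) / N) * m (intermediateSet B₀ B₁ t) ^ (1 / N) ≤ R := by
    intro ε hε0 hε1
    obtain ⟨E, hEI, hEm, hE⟩ := hμ.exists_subset_intermediateSet hW hB₀ hB₁
      (by rw [hμ0]; exact withDensity_uniform_compl m hB₀)
      (by rw [hμ1]; exact withDensity_uniform_compl m hB₁) ht hε0 hε1
    have hE1 : 1 - ε ≤ μ t E := by
      rw [tsub_le_iff_right, ← measure_univ (μ := μ t), ← measure_add_measure_compl hEm]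
      gcongr
    have hEpos : m E ≠ 0 := by
      intro h0
      rw [hac h0, nonpos_iff_eq_zero, tsub_eq_zero_iff_le] at hE1
      exact absurd hε1 (not_lt.2 hE1)
    have hEr : ∫⁻ x in E, (μ t).rnDeriv m x ∂m = μ t E := by
      rw [Measure.setLIntegral_rnDeriv hac]
    calc _ ≤ (∫⁻ x in E, (μ t).rnDeriv m x ∂m) ^ ((N - 1) / N) * m E ^ (1 / N) := by
          rw [hEr]
          refine mul_le_mul' (ENNReal.rpow_le_rpow hE1 hp0) ?_
          exact rpow_le_rpow_of_nonpos (by simpa using hN.le) (measure_mono hEI)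
      _ ≤ _ := rpow_mul_rpow_le_lintegral m hN hEpos
          (ne_top_of_le_ne_top hIT (measure_mono hEI)) (Measure.measurable_rnDeriv _ _)
      _ ≤ R := hSR
  have hlim : Tendsto (fun ε : ℝ≥0∞ => (1 - ε) ^ ((N - 1) / N) *
      m (intermediateSet B₀ B₁ t) ^ (1 / N)) (𝓝[>] 0)
      (𝓝 (m (intermediateSet B₀ B₁ t) ^ (1 / N))) := by
    have h1 : Tendsto (fun ε : ℝ≥0∞ => (1 - ε) ^ ((N - 1) / N)) (𝓝[>] 0) (𝓝 1) := by
      have hc : Continuous fun ε : ℝ≥0∞ => (1 - ε) ^ ((N - 1) / N) :=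
        ENNReal.continuous_rpow_const.comp (ENNReal.continuous_sub_left ENNReal.one_ne_top)
      simpa using (hc.tendsto 0).mono_left nhdsWithin_le_nhds
    simpa using ENNReal.Tendsto.mul_const h1 (Or.inl one_ne_zero)
  refine le_of_tendsto hlim ?_
  filter_upwards [eventually_mem_nhdsWithin, (eventually_lt_nhds one_pos).filter_mono
    nhdsWithin_le_nhds] with ε h0 h1
  exact key ε (ne_of_gt h0) h1

/-- The Brunn–Minkowski inequality, with general distortion coefficients. -/
theorem CurvDimWith.brunnMinkowski [BorelSpace X] [CompleteSpace X]
    [SecondCountableTopology X] {m : Measure X} [SigmaFinite m] {N : ℝ} (hN : N < 0)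
    {β : ℝ → ℝ → ℝ → ℝ≥0∞} (h : CurvDimWith β N m) {A₀ A₁ : Set X} (hA₀ : MeasurableSet A₀) (hA₁ : MeasurableSet A₁)
    (hne₀ : A₀.Nonempty) (hne₁ : A₁.Nonempty) {t : ℝ} (ht : t ∈ Icc (0 : ℝ) 1)
    (ht0 : t = 0 → m A₁ ≠ 0) (ht1 : t = 1 → m A₀ ≠ 0)
    {T : ℝ → ℝ≥0∞} (hT : ∀ s ∈ Icc (0 : ℝ) 1, T s ≠ ∞)
    (hβT : ∀ s ∈ Icc (0 : ℝ) 1, ∀ x ∈ A₀, ∀ y ∈ A₁, β N s (dist x y) ≤ T s)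
    (hβ : ∀ s ∈ Ioc (0 : ℝ) 1, ∀ x ∈ A₀, ∀ y ∈ A₁, β N s (dist x y) ≠ 0) :
    m (intermediateSet A₀ A₁ t) ^ (1 / N) ≤
      (⨆ x ∈ A₀, ⨆ y ∈ A₁, β N (1 - t) (dist x y)) * m A₀ ^ (1 / N) +
      (⨆ x ∈ A₀, ⨆ y ∈ A₁, β N t (dist x y)) * m A₁ ^ (1 / N) := by
  have ht' : 1 - t ∈ Icc (0 : ℝ) 1 := ⟨by linarith [ht.2], by linarith [ht.1]⟩
  have hN' : 1 / N < 0 := by simpa using hN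
  let S : ℝ → ℝ≥0∞ := fun s => ⨆ x ∈ A₀, ⨆ y ∈ A₁, β N s (dist x y)
  have hle : ∀ s, ∀ x ∈ A₀, ∀ y ∈ A₁, β N s (dist x y) ≤ S s := fun s x hx y hy =>
    (le_iSup₂ (f := fun y _ => β N s (dist x y)) y hy).trans
      (le_iSup₂ (f := fun x _ => ⨆ y ∈ A₁, β N s (dist x y)) x hx)
  have hS : ∀ s ∈ Icc (0 : ℝ) 1, S s ≠ ∞ := fun s hs => ne_top_of_le_ne_top (hT s hs)
    (iSup₂_le fun x hx => iSup₂_le fun y hy => hβT s hs x hx y hy)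
  have hS0 : ∀ s ∈ Ioc (0 : ℝ) 1, S s ≠ 0 := fun s hs h0 => by
    obtain ⟨x, hx⟩ := hne₀
    obtain ⟨y, hy⟩ := hne₁
    exact hβ s hs x hx y hy (nonpos_iff_eq_zero.1 ((hle s x hx y hy).trans h0.le))
  change _ ≤ S (1 - t) * _ + S t * _
  by_cases h₀ : m A₀ = 0
  -- A null set contributes `0 ^ (1 / N) = ∞` times a nonzero coefficient, so the right-hand side is
  -- `∞`. The assumptions at `t = 0` and `t = 1` exclude a vanishing coefficient here.
  · have : 1 - t ∈ Ioc (0 : ℝ) 1 := ⟨sub_pos.2 (lt_of_le_of_ne ht.2 fun h => ht1 h h₀), ht'.2⟩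
    rw [h₀, ENNReal.zero_rpow_of_neg hN', ENNReal.mul_top (hS0 _ this), top_add]
    exact le_top
  by_cases h₁ : m A₁ = 0
  · have : t ∈ Ioc (0 : ℝ) 1 := ⟨lt_of_le_of_ne ht.1 fun h => ht0 h.symm h₁, ht.2⟩
    rw [h₁, ENNReal.zero_rpow_of_neg hN', ENNReal.mul_top (hS0 _ this), add_top]
    exact le_top
  obtain ⟨o, -⟩ := hne₀
  let U : ℕ → Set X := fun n => Metric.closedBall o n ∩ spanningSets m n
  have hUm : Monotone U := fun n k hnk => inter_subset_inter
    (Metric.closedBall_subset_closedBall (by exact_mod_cast hnk)) (monotone_spanningSets m hnk)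
  have hUmeas : ∀ n, MeasurableSet (U n) := fun n =>
    measurableSet_closedBall.inter (measurableSet_spanningSets m n)
  have hUu : ⋃ n, U n = univ := by
    rw [eq_univ_iff_forall]
    intro x
    have hx : x ∈ ⋃ n, spanningSets m n := by rw [iUnion_spanningSets]; trivial
    obtain ⟨n, hn⟩ := mem_iUnion.1 hx
    obtain ⟨k, hk⟩ := exists_nat_ge (dist x o)
    refine mem_iUnion.2 ⟨max n k, ?_, monotone_spanningSets m (le_max_left n k) hn⟩
    refine Metric.mem_closedBall.2 (hk.trans ?_)
    exact_mod_cast le_max_right n k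
  have hlim : ∀ A : Set X, Tendsto (fun n => m (A ∩ U n)) atTop (𝓝 (m A)) := by
    intro A
    have := tendsto_measure_iUnion_atTop (μ := m) (s := fun n => A ∩ U n)
      (fun n k hnk => inter_subset_inter_right A (hUm hnk))
    rwa [← inter_iUnion, hUu, inter_univ] at this
  have hlim' : ∀ A : Set X, ∀ s ∈ Icc (0 : ℝ) 1,
      Tendsto (fun n => S s * m (A ∩ U n) ^ (1 / N)) atTop (𝓝 (S s * m A ^ (1 / N))) :=
    fun A s hs => ENNReal.Tendsto.const_mul
      ((ENNReal.continuous_rpow_const.tendsto _).comp (hlim A)) (Or.inr (hS s hs))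
  -- The coefficients stay those of the full sets while the measures converge from below. Passing to
  -- the limit needs finite coefficients, as `m A ^ (1 / N)` may tend to `0`.
  refine ge_of_tendsto ((hlim' A₀ _ ht').add (hlim' A₁ _ ht)) ?_
  filter_upwards [(hlim A₀).eventually_ne h₀, (hlim A₁).eventually_ne h₁] with n hn₀ hn₁
  have hfin : ∀ A : Set X, m (A ∩ U n) ≠ ∞ := fun A => ne_top_of_le_ne_top
    (measure_spanningSets_lt_top m n).ne (measure_mono (inter_subset_right.trans inter_subset_right))
  refine le_trans ?_ (h.brunnMinkowski_of_bounded hN (hA₀.inter (hUmeas n)) (hA₁.inter (hUmeas n))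
    hn₀ hn₁ (hfin _) (hfin _) ?_ ht (hS _ ht') (hS _ ht)
    (fun x hx y hy => hle _ x hx.1 y hy.1) (fun x hx y hy => hle _ x hx.1 y hy.1))
  · exact rpow_le_rpow_of_nonpos hN'.le
      (measure_mono (intermediateSet_mono inter_subset_left inter_subset_left t))
  · refine ne_top_of_le_ne_top (Metric.isBounded_closedBall (x := o) (r := n)).ediam_ne_top
      (Metric.ediam_mono ?_)
    exact union_subset (inter_subset_right.trans inter_subset_left)
      (inter_subset_right.trans inter_subset_left)

end NegCD

/-! ### Bounds on the distortion coefficients -/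

namespace NegCD

theorem sinK_pos {κ x : ℝ} (hx : 0 < x) (h : 0 < κ → x < Real.pi / √κ) : 0 < sinK κ x := by
  rw [sinK]
  split_ifs with h1 h2
  · have hk : 0 < √κ := Real.sqrt_pos.2 h1
    refine div_pos (Real.sin_pos_of_pos_of_lt_pi (by positivity) ?_) hk
    rw [mul_comm]
    exact (lt_div_iff₀ hk).1 (h h1)
  · exact hx
  · have hk : 0 < √(-κ) := Real.sqrt_pos.2 (by grind)
    exact div_pos (Real.sinh_pos_iff.2 (by positivity)) hk

theorem sigma_ne_zero {κ s θ : ℝ} (hs : s ∈ Ioc (0 : ℝ) 1) (hθ : 0 ≤ θ) : sigma κ s θ ≠ 0 := by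
  rw [sigma]
  split_ifs with h1 h2
  · simp
  · simpa using hs.1
  · have hθ0 : 0 < θ := lt_of_le_of_ne hθ (Ne.symm h2)
    have hlt : 0 < κ → θ < Real.pi / √κ := fun hκ => by grind
    have hle : s * θ ≤ θ := mul_le_of_le_one_left hθ hs.2
    simpa using div_pos (sinK_pos (mul_pos hs.1 hθ0) fun hκ => hle.trans_lt (hlt hκ))
      (sinK_pos hθ0 hlt)

/-- Up to `π / 2` the sine is increasing and the quotient is at most `1`. Beyond, the sine
decreases, so the denominator is at least `sin y`. -/
theorem sin_mul_div_sin_le {s x y : ℝ} (hs : s ∈ Icc (0 : ℝ) 1) (hx : 0 < x) (hxy : x ≤ y)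
    (hy : y < Real.pi) : Real.sin (s * x) / Real.sin x ≤ max 1 (1 / Real.sin y) := by
  have hpos : 0 < Real.sin x := Real.sin_pos_of_pos_of_lt_pi hx (hxy.trans_lt hy)
  rcases le_total x (Real.pi / 2) with h | h
  · refine le_max_of_le_left ((div_le_one hpos).2 ?_)
    have hle : s * x ≤ x := mul_le_of_le_one_left hx.le hs.2
    exact Real.sin_le_sin_of_le_of_le_pi_div_two
      (by have := mul_nonneg hs.1 hx.le; linarith [Real.pi_pos]) h hle
  · refine le_max_of_le_right ?_
    have hy0 : 0 < Real.sin y := Real.sin_pos_of_pos_of_lt_pi (hx.trans_le hxy) hy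
    have hxy' : Real.sin y ≤ Real.sin x := by
      rw [← Real.sin_pi_sub y, ← Real.sin_pi_sub x]
      exact Real.sin_le_sin_of_le_of_le_pi_div_two (by linarith) (by linarith) (by linarith)
    gcongr
    exact Real.sin_le_one _

/-- For `κ ≤ 0` monotonicity of the identity or of `sinh` gives the bound `1`, so `D` matters only
for `κ > 0`, where it keeps `θ` away from the pole at `π / √κ`. -/
theorem exists_sigma_le {κ D : ℝ} (hD : 0 < κ → D < Real.pi / √κ) :
    ∃ C : ℝ≥0∞, C ≠ ∞ ∧ ∀ s ∈ Icc (0 : ℝ) 1, ∀ θ, 0 ≤ θ → (0 < κ → θ ≤ D) → sigma κ s θ ≤ C := by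
  refine ⟨ENNReal.ofReal (max 1 (1 / Real.sin (√κ * D))), ENNReal.ofReal_ne_top, ?_⟩
  intro s hs θ hθ hθD
  rw [sigma]
  split_ifs with h1 h2
  · exact absurd ((hθD h1.1).trans_lt (hD h1.1)) (not_lt.2 h1.2)
  · exact ENNReal.ofReal_le_ofReal (le_max_of_le_left hs.2)
  · have hθ0 : 0 < θ := lt_of_le_of_ne hθ (Ne.symm h2)
    have hle : s * θ ≤ θ := mul_le_of_le_one_left hθ hs.2
    refine ENNReal.ofReal_le_ofReal ?_
    rw [sinK, sinK]
    split_ifs with h3 h4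
    · have hk : 0 < √κ := Real.sqrt_pos.2 h3
      rw [div_div_div_cancel_right₀ hk.ne', mul_left_comm]
      refine sin_mul_div_sin_le hs (by positivity) (by gcongr; exact hθD h3) ?_
      rw [mul_comm]
      exact (lt_div_iff₀ hk).1 (hD h3)
    · exact le_max_of_le_left ((div_le_one hθ0).2 hle)
    · have hk : 0 < √(-κ) := Real.sqrt_pos.2 (by grind)
      rw [div_div_div_cancel_right₀ hk.ne']
      refine le_max_of_le_left ((div_le_one (Real.sinh_pos_iff.2 (by positivity))).2 ?_)
      exact Real.sinh_le_sinh.2 (by gcongr)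

theorem pi_div_sqrt_div (K N : ℝ) : Real.pi / √(K / N) = Real.pi * √(N / K) := by
  rw [← inv_div N K, Real.sqrt_inv, div_inv_eq_mul]

theorem div_pos_iff_of_neg {K N : ℝ} (hN : N < 0) : 0 < K / N ↔ K < 0 := by
  rw [div_pos_iff]
  grind

theorem tau_ne_zero {K N s θ : ℝ} (hN : N < 0) (hs : s ∈ Ioc (0 : ℝ) 1) (hθ : 0 ≤ θ) :
    tau K N s θ ≠ 0 := by
  have hp : 0 < (N - 1) / N := div_pos_of_neg_of_neg (by linarith) hN
  rw [tau]
  split_ifs with h1 h2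
  · simp
  · exact absurd h2 hs.1.ne'
  · refine mul_ne_zero ?_ ?_
    · rw [Ne, ENNReal.rpow_eq_zero_iff]
      simp [hs.1.not_ge]
    · rw [Ne, ENNReal.rpow_eq_zero_iff]
      simp [sigma_ne_zero hs hθ, hp.not_gt]

theorem tau_le {K N s θ : ℝ} (hN : N < 0) {C : ℝ≥0∞} (hC : sigma (K / (N - 1)) s θ ≤ C)
    (hθ : K < 0 → θ < Real.pi * √((N - 1) / K)) :
    tau K N s θ ≤ if s = 0 then 0 else ENNReal.ofReal s ^ (1 / N) * C ^ ((N - 1) / N) := by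
  have hp : 0 < (N - 1) / N := div_pos_of_neg_of_neg (by linarith) hN
  rw [tau, if_neg fun h => absurd (hθ h.1) (not_lt.2 h.2)]
  split_ifs with h
  · exact le_rfl
  · gcongr

theorem dist_le_toReal_ediam {X : Type*} [MetricSpace X] {A : Set X} {c : ℝ}
    (h : Metric.ediam A < ENNReal.ofReal c) {x y : X} (hx : x ∈ A) (hy : y ∈ A) :
    dist x y ≤ (Metric.ediam A).toReal := by
  rw [dist_edist]
  exact ENNReal.toReal_mono (ne_top_of_lt h) (Metric.edist_le_ediam_of_mem hx hy)

end NegCD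

theorem theorem4p4 {X : Type*} [MetricSpace X] [CompleteSpace X]
    [TopologicalSpace.SeparableSpace X] [MeasurableSpace X] [BorelSpace X]
    (m : Measure X) [SigmaFinite m] (K N : ℝ) (hN : N < 0) :
    (NegCD.CD K N m →
      ∀ A₀ A₁ : Set X, MeasurableSet A₀ → MeasurableSet A₁ → A₀.Nonempty → A₁.Nonempty →
        (K < 0 → Metric.ediam (A₀ ∪ A₁) < ENNReal.ofReal (Real.pi * √((N - 1) / K))) →
        ∀ t ∈ Icc (0 : ℝ) 1, (t = 0 → m A₁ ≠ 0) → (t = 1 → m A₀ ≠ 0) →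
          m (NegCD.intermediateSet A₀ A₁ t) ^ (1 / N) ≤
            (⨆ x ∈ A₀, ⨆ y ∈ A₁, NegCD.tau K N (1 - t) (dist x y)) * m A₀ ^ (1 / N) +
            (⨆ x ∈ A₀, ⨆ y ∈ A₁, NegCD.tau K N t (dist x y)) * m A₁ ^ (1 / N)) ∧
    (NegCD.CDStar K N m →
      ∀ A₀ A₁ : Set X, MeasurableSet A₀ → MeasurableSet A₁ → A₀.Nonempty → A₁.Nonempty →
        (K < 0 → Metric.ediam (A₀ ∪ A₁) < ENNReal.ofReal (Real.pi * √(N / K))) →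
        ∀ t ∈ Icc (0 : ℝ) 1, (t = 0 → m A₁ ≠ 0) → (t = 1 → m A₀ ≠ 0) →
          m (NegCD.intermediateSet A₀ A₁ t) ^ (1 / N) ≤
            (⨆ x ∈ A₀, ⨆ y ∈ A₁, NegCD.sigma (K / N) (1 - t) (dist x y)) * m A₀ ^ (1 / N) +
            (⨆ x ∈ A₀, ⨆ y ∈ A₁, NegCD.sigma (K / N) t (dist x y)) * m A₁ ^ (1 / N)) := by
  have : SecondCountableTopology X := UniformSpace.secondCountable_of_separable X
  have hN1 : N - 1 < 0 := by linarith
  constructor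
  · intro h A₀ A₁ hA₀ hA₁ hne₀ hne₁ hd t ht ht0 ht1
    have hlt : K < 0 → (Metric.ediam (A₀ ∪ A₁)).toReal < Real.pi * √((N - 1) / K) :=
      fun hK => ENNReal.toReal_lt_of_lt_ofReal (hd hK)
    have hle : K < 0 → ∀ x ∈ A₀, ∀ y ∈ A₁, dist x y ≤ (Metric.ediam (A₀ ∪ A₁)).toReal :=
      fun hK x hx y hy => NegCD.dist_le_toReal_ediam (hd hK) (Or.inl hx) (Or.inr hy)
    obtain ⟨C, hC, hσ⟩ := NegCD.exists_sigma_le (κ := K / (N - 1))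
      (D := (Metric.ediam (A₀ ∪ A₁)).toReal) (by
        rwa [NegCD.pi_div_sqrt_div, NegCD.div_pos_iff_of_neg hN1])
    rw [NegCD.div_pos_iff_of_neg hN1] at hσ
    refine NegCD.CurvDimWith.brunnMinkowski hN h hA₀ hA₁ hne₀ hne₁ ht ht0 ht1
      -- At `s = 0` the product formula would contain `0 ^ (1 / N) = ∞`, so the bound needs the same
      -- exception as `tau`.
      (T := fun s => if s = 0 then 0 else ENNReal.ofReal s ^ (1 / N) * C ^ ((N - 1) / N)) ?_ ?_ ?_
    · intro s hs
      split_ifs with h0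
      · exact ENNReal.zero_ne_top
      · refine ENNReal.mul_ne_top (ENNReal.rpow_ne_top_of_ne_zero ?_ ENNReal.ofReal_ne_top)
          (ENNReal.rpow_ne_top_of_nonneg (div_pos_of_neg_of_neg hN1 hN).le hC)
        simpa using lt_of_le_of_ne hs.1 (Ne.symm h0)
    · intro s hs x hx y hy
      exact NegCD.tau_le hN (hσ s hs _ dist_nonneg fun hK => hle hK x hx y hy)
        fun hK => (hle hK x hx y hy).trans_lt (hlt hK)
    · exact fun s hs x _ y _ => NegCD.tau_ne_zero hN hs dist_nonneg
  · intro h A₀ A₁ hA₀ hA₁ hne₀ hne₁ hd t ht ht0 ht1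
    have hlt : K < 0 → (Metric.ediam (A₀ ∪ A₁)).toReal < Real.pi * √(N / K) :=
      fun hK => ENNReal.toReal_lt_of_lt_ofReal (hd hK)
    have hle : K < 0 → ∀ x ∈ A₀, ∀ y ∈ A₁, dist x y ≤ (Metric.ediam (A₀ ∪ A₁)).toReal :=
      fun hK x hx y hy => NegCD.dist_le_toReal_ediam (hd hK) (Or.inl hx) (Or.inr hy)
    obtain ⟨C, hC, hσ⟩ := NegCD.exists_sigma_le (κ := K / N)
      (D := (Metric.ediam (A₀ ∪ A₁)).toReal) (by
        rwa [NegCD.pi_div_sqrt_div, NegCD.div_pos_iff_of_neg hN])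
    rw [NegCD.div_pos_iff_of_neg hN] at hσ
    exact NegCD.CurvDimWith.brunnMinkowski hN h hA₀ hA₁ hne₀ hne₁ ht ht0 ht1
      (T := fun _ => C) (fun _ _ => hC)
      (fun s hs x hx y hy => hσ s hs _ dist_nonneg fun hK => hle hK x hx y hy)
      (fun s hs x _ y _ => NegCD.sigma_ne_zero hs dist_nonneg)
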